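/- Let $Y$ be an arbitrary topological space and let $y_0\in Y$. For a space $X$, give the path space $\mathcal{P}X$ of all continuous maps $[0,1]\to X$ the compact-open topology. A path $\alpha\in\mathcal{P}X$ is \emph{well-ended} (respectively \emph{locally well-ended}) if for every open neighborhood $U$ of $\alpha$ in $\mathcal{P}X$ there are open neighborhoods $V_0,V_1$ of $\alpha(0),\alpha(1)$ in $X$ such that for all $a\in V_0$, $b\in V_1$ there is a path (respectively a well-ended path) $\beta\in U$ with $\beta(0)=a$ and $\beta(1)=b$. The space $X$ is \emph{locally wep-connected} if every pair of points of $X$ can be connected by a locally well-ended path. For $x_0\in X$ let $\pi_1^{\tau}(X,x_0)$ denote the fundamental group $\pi_1(X,x_0)$ equipped with the finest group topology for which the canonical map $\Omega(X,x_0)\to\pi_1(X,x_0)$, $\gamma\mapsto[\gamma]$, is continuous, where the loop space $\Omega(X,x_0)$ carries the compact-open topology. Then there are a locally wep-connected space $X$, a point $x_0\in X$ and a continuous map $f\colon X\to Y$ with $f(x_0)=y_0$ such that the induced homomorphism $\pi_1^{\tau}(X,x_0)\to\pi_1^{\tau}(Y,y_0)$, $[\gamma]\mapsto[f\circ\gamma]$,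 is an isomorphism of topological groups (a group isomorphism that is also a homeomorphism). -/

import Mathlib

open scoped unitInterval

universe u v

section WellEnded

variable {X : Type u} [TopologicalSpace X]

/-- A path `α : I → X` is well-ended if every open neighborhood of `α` in the path space `C(I, X)`
(with the compact-open topology) contains paths joining all points near `α 0` to all points
near `α 1`. -/
def WellEnded (α : C(I, X)) : Prop :=
  ∀ U : Set C(I, X), IsOpen U → α ∈ U →
    ∃ V₀ V₁ : Set X, IsOpen V₀ ∧ IsOpen V₁ ∧ α 0 ∈ V₀ ∧ α 1 ∈ V₁ ∧
      ∀ a ∈ V₀, ∀ b ∈ V₁, ∃ β ∈ U, β 0 = a ∧ β 1 = b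

/-- A path `α : I → X` is locally well-ended if every open neighborhood of `α` in the path space
contains well-ended paths joining all points near `α 0` to all points near `α 1`. -/
def LocallyWellEnded (α : C(I, X)) : Prop :=
  ∀ U : Set C(I, X), IsOpen U → α ∈ U →
    ∃ V₀ V₁ : Set X, IsOpen V₀ ∧ IsOpen V₁ ∧ α 0 ∈ V₀ ∧ α 1 ∈ V₁ ∧
      ∀ a ∈ V₀, ∀ b ∈ V₁, ∃ β ∈ U, WellEnded β ∧ β 0 = a ∧ β 1 = b

variable (X) in
/-- A space is locally wep-connected if every pair of points can be connected by a
locally well-ended path. -/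
def LocallyWepConnected : Prop :=
  ∀ x y : X, ∃ α : C(I, X), LocallyWellEnded α ∧ α 0 = x ∧ α 1 = y

end WellEnded

noncomputable section PiOneTau

/-- The underlying group of `π₁^τ(X, x)` is the fundamental group `π₁(X, x)`. -/
def PiOneTau (X : Type u) [TopologicalSpace X] (x : X) : Type u := FundamentalGroup X x

namespace PiOneTau

instance instGroup (X : Type u) [TopologicalSpace X] (x : X) : Group (PiOneTau X x) :=
  inferInstanceAs (Group (FundamentalGroup X x))

/-- The canonical map from the loop space `Ω(X, x)` (with the compact-open topology) to
`π₁(X, x)`, sending a loop to its homotopy class. -/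
def ofLoop {X : Type u} [TopologicalSpace X] {x : X} (γ : Path x x) : PiOneTau X x :=
  FundamentalGroup.fromPath (Path.Homotopic.Quotient.mk γ)

/-- The finest group topology on `π₁(X, x)` for which `ofLoop : Ω(X, x) → π₁(X, x)` is
continuous. -/
def groupTopology (X : Type u) [TopologicalSpace X] (x : X) : GroupTopology (PiOneTau X x) :=
  GroupTopology.coinduced (ofLoop : Path x x → PiOneTau X x)

instance instTopologicalSpace (X : Type u) [TopologicalSpace X] (x : X) :
    TopologicalSpace (PiOneTau X x) :=
  (groupTopology X x).toTopologicalSpace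

instance instIsTopologicalGroup (X : Type u) [TopologicalSpace X] (x : X) :
    IsTopologicalGroup (PiOneTau X x) :=
  (groupTopology X x).toIsTopologicalGroup

/-- The homomorphism `π₁(X, x) → π₁(Y, y)`, `[γ] ↦ [f ∘ γ]`, induced by a based map `f`. -/
def map {X : Type u} {Y : Type v} [TopologicalSpace X] [TopologicalSpace Y] {x : X} {y : Y}
    (f : C(X, Y)) (hf : f x = y) : PiOneTau X x →* PiOneTau Y y :=
  FundamentalGroup.mapOfEq f hf

end PiOneTau

end PiOneTau

/-! The space `X` is given one circle for every loop of `Y` and one disc for every null-homotopy.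
The quotient `LoopWedge` of `Ω(Y, y₀) × I` that collapses both ends to a point maps to `Y` by
evaluation. A disc is then attached for every boundary map to it, together with an extension to the
disc of its image in `Y`.

Sending a loop to its circle is a continuous section on loop spaces. Hence the induced homomorphism
is onto, and once it is injective its inverse is continuous by the universal property of `π₁^τ`
(`exists_continuousMulEquiv`). For injectivity, every loop of `X` deforms into `LoopWedge`
(`exists_homotopic_basePath`), and a loop there that dies in `Y` bounds an attached disc
(`homotopic_refl_of_eval`). The deformation is a groupoid argument: path classes whose closures lie
in the image of the group of the base form a subgroupoid, so only small paths have to be checked.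

Local wep-connectedness needs no hypothesis on `Ω(Y, y₀)`, because every point can travel to the
base point along its own disc and circle. In a continuous family of such paths with openly varying
starting points every member is well-targeted (`wellTargeted_of_family`). The base point is treated
separately: nearby points take the short way round. Joining two paths to the base point gives a
locally well-ended path. -/

open scoped unitInterval
open Set Filter Topology

universe w


/-! ### Isomorphisms of the topologized fundamental group -/

noncomputable section PiOneTauIso

namespace PiOneTau

/-- The universal property of the topology of `π₁^τ(X, x)`. -/
theorem continuous_of_comp_ofLoop {X : Type u} [TopologicalSpace X] {x : X} {G : Type v} [Group G]
    [TopologicalSpace G] [IsTopologicalGroup G] (φ : PiOneTau X x →* G)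
    (h : Continuous fun γ : Path x x => φ (ofLoop γ)) : Continuous φ := by
  -- Pulling the topology of `G` back along `φ` gives a group topology that makes `ofLoop`
  -- continuous, so it competes in the infimum defining `groupTopology`.
  let b : GroupTopology (PiOneTau X x) :=
    { toTopologicalSpace := TopologicalSpace.induced φ inferInstance
      toIsTopologicalGroup := topologicalGroup_induced φ }
  have hb : groupTopology X x ≤ b := by
    refine sInf_le ?_
    change TopologicalSpace.coinduced _ _ ≤ TopologicalSpace.induced φ _
    rw [← continuous_iff_coinduced_le, continuous_induced_rng]
    exact h
  exact continuous_iff_le_induced.2 hb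

theorem continuous_ofLoop {X : Type u} [TopologicalSpace X] {x : X} :
    Continuous (ofLoop : Path x x → PiOneTau X x) :=
  GroupTopology.coinduced_continuous _

theorem ofLoop_surjective {X : Type u} [TopologicalSpace X] {x : X} :
    Function.Surjective (ofLoop : Path x x → PiOneTau X x) :=
  Path.Homotopic.Quotient.mk_surjective

theorem ofLoop_eq_iff {X : Type u} [TopologicalSpace X] {x : X} {γ δ : Path x x} :
    ofLoop γ = ofLoop δ ↔ γ.Homotopic δ :=
  Path.Homotopic.Quotient.eq

variable {X : Type u} {Y : Type v} [TopologicalSpace X] [TopologicalSpace Y] {x : X} {y : Y}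

theorem map_ofLoop (f : C(X, Y)) (hf : f x = y) (γ : Path x x) :
    map f hf (ofLoop γ) = ofLoop ((γ.map f.continuous).cast hf.symm hf.symm) :=
  FundamentalGroup.mapOfEq_apply f hf _

theorem continuous_map (f : C(X, Y)) (hf : f x = y) : Continuous (map f hf) := by
  refine continuous_of_comp_ofLoop _ ?_
  simp only [map_ofLoop]
  refine continuous_ofLoop.comp ?_
  refine continuous_induced_rng.2 ?_
  exact (ContinuousMap.continuous_postcomp f).comp continuous_induced_dom

/-- A based map which has a continuous section on loops and is injective on fundamental groups
induces an isomorphism of topological groups. -/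
theorem exists_continuousMulEquiv (f : C(X, Y)) (hf : f x = y) (s : Path y y → Path x x)
    (hs : Continuous s) (hfs : ∀ γ t, f (s γ t) = γ t)
    (hinj : ∀ γ : Path x x,
      ((γ.map f.continuous).cast hf.symm hf.symm).Homotopic (Path.refl y) →
        γ.Homotopic (Path.refl x)) :
    ∃ e : PiOneTau X x ≃ₜ* PiOneTau Y y, ∀ g : PiOneTau X x, e g = map f hf g := by
  have hmap : ∀ γ, map f hf (ofLoop (s γ)) = ofLoop γ := by
    intro γ
    rw [map_ofLoop]
    congr 1
    ext t
    exact hfs γ t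
  have hbij : Function.Bijective (map f hf) := by
    constructor
    · rw [injective_iff_map_eq_one]
      intro a ha
      obtain ⟨γ, rfl⟩ := ofLoop_surjective a
      rw [map_ofLoop] at ha
      exact ofLoop_eq_iff.2 (hinj γ (ofLoop_eq_iff.1 ha))
    · intro b
      obtain ⟨γ, rfl⟩ := ofLoop_surjective b
      exact ⟨_, hmap γ⟩
  let e := MulEquiv.ofBijective (map f hf) hbij
  refine ⟨{ e with
    continuous_toFun := continuous_map f hf
    continuous_invFun := ?_ }, fun g => rfl⟩
  refine continuous_of_comp_ofLoop e.symm.toMonoidHom ?_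
  -- On loop classes the inverse is induced by the section `s`, so its continuity follows from that
  -- of `s`.
  have : (fun γ : Path y y => e.symm.toMonoidHom (ofLoop γ)) = fun γ => ofLoop (s γ) := by
    funext γ
    exact e.symm_apply_eq.2 (hmap γ).symm
  rw [this]
  exact continuous_ofLoop.comp hs

end PiOneTau

end PiOneTauIso

/-! ### Well-targeted paths to a base point -/

section WellTargeted

variable {X : Type u} [TopologicalSpace X] {x₀ : X}

variable (x₀) in
/-- The space of paths ending at `x₀`. -/
abbrev PathsTo : Type u := {α : C(I, X) // α 1 = x₀}

namespace PathsTo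

/-- A path ending at `x₀`, regarded as a point of the space of all of them. -/
def ofPath {x : X} (γ : Path x x₀) : PathsTo x₀ := ⟨γ.toContinuousMap, γ.target⟩

/-- The path underlying a point of `PathsTo x₀`. -/
def toPath (α : PathsTo x₀) : Path (α.1 0) x₀ := ⟨α.1, rfl, α.2⟩

theorem continuous_ofPath {J : Type v} [TopologicalSpace J] {e : J → X} (γ : ∀ j, Path (e j) x₀)
    (h : Continuous fun p : J × I => γ p.1 p.2) : Continuous fun j => ofPath (γ j) :=
  Continuous.subtype_mk (ContinuousMap.continuous_of_continuous_uncurry _ h) _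

/-- The path running along `α` and then backwards along `β`. -/
noncomputable def join (p : PathsTo x₀ × PathsTo x₀) : C(I, X) :=
  (p.1.toPath.trans p.2.toPath.symm).toContinuousMap

theorem continuous_join : Continuous (join : PathsTo x₀ × PathsTo x₀ → C(I, X)) := by
  refine ContinuousMap.continuous_of_continuous_uncurry _ ?_
  refine Path.trans_continuous_family (fun p : PathsTo x₀ × PathsTo x₀ => p.1.toPath) ?_
    (fun p => p.2.toPath.symm) ?_
  · change Continuous fun q : (PathsTo x₀ × PathsTo x₀) × I => q.1.1.1 q.2
    fun_prop
  · change Continuous fun q : (PathsTo x₀ × PathsTo x₀) × I => q.1.2.1 (σ q.2)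
    fun_prop

theorem join_zero (p : PathsTo x₀ × PathsTo x₀) : join p 0 = p.1.1 0 := Path.source _

theorem join_one (p : PathsTo x₀ × PathsTo x₀) : join p 1 = p.2.1 0 := Path.target _

/-- A path ending at `x₀` is well-targeted if its neighborhoods contain paths from all nearby
points to `x₀`. -/
def WellTargeted (α : PathsTo x₀) : Prop :=
  ∀ U ∈ 𝓝 α, ∀ᶠ a in 𝓝 (α.1 0), ∃ β ∈ U, β.1 0 = a

/-- A path ending at `x₀` is locally well-targeted if its neighborhoods contain well-targeted
paths from all nearby points to `x₀`. -/
def LocallyWellTargeted (α : PathsTo x₀) : Prop :=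
  ∀ U ∈ 𝓝 α, ∀ᶠ a in 𝓝 (α.1 0), ∃ β ∈ U, WellTargeted β ∧ β.1 0 = a

/-- Since `join` is continuous, a neighborhood of the joined path contains all joins from a product
of neighborhoods, so the two endpoints can be moved independently. -/
theorem WellTargeted.wellEnded_join {α β : PathsTo x₀} (hα : WellTargeted α)
    (hβ : WellTargeted β) : WellEnded (join (α, β)) := by
  intro U hU hmem
  have := continuous_join.continuousAt.preimage_mem_nhds (hU.mem_nhds hmem)
  rw [nhds_prod_eq, mem_prod_iff] at this
  obtain ⟨U₀, h₀, U₁, h₁, hsub⟩ := this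
  obtain ⟨V₀, hV₀, oV₀, mV₀⟩ := eventually_nhds_iff.1 (hα U₀ h₀)
  obtain ⟨V₁, hV₁, oV₁, mV₁⟩ := eventually_nhds_iff.1 (hβ U₁ h₁)
  refine ⟨V₀, V₁, oV₀, oV₁, by rwa [join_zero], by rwa [join_one], fun a ha b hb => ?_⟩
  obtain ⟨α', hα', rfl⟩ := hV₀ a ha
  obtain ⟨β', hβ', rfl⟩ := hV₁ b hb
  exact ⟨join (α', β'), hsub (mk_mem_prod hα' hβ'), join_zero _, join_one _⟩

theorem LocallyWellTargeted.locallyWellEnded_join {α β : PathsTo x₀} (hα : LocallyWellTargeted α)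
    (hβ : LocallyWellTargeted β) : LocallyWellEnded (join (α, β)) := by
  intro U hU hmem
  have := continuous_join.continuousAt.preimage_mem_nhds (hU.mem_nhds hmem)
  rw [nhds_prod_eq, mem_prod_iff] at this
  obtain ⟨U₀, h₀, U₁, h₁, hsub⟩ := this
  obtain ⟨V₀, hV₀, oV₀, mV₀⟩ := eventually_nhds_iff.1 (hα U₀ h₀)
  obtain ⟨V₁, hV₁, oV₁, mV₁⟩ := eventually_nhds_iff.1 (hβ U₁ h₁)
  refine ⟨V₀, V₁, oV₀, oV₁, by rwa [join_zero], by rwa [join_one], fun a ha b hb => ?_⟩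
  obtain ⟨α', hα', wα', rfl⟩ := hV₀ a ha
  obtain ⟨β', hβ', wβ', rfl⟩ := hV₁ b hb
  exact ⟨join (α', β'), hsub (mk_mem_prod hα' hβ'), wα'.wellEnded_join wβ', join_zero _,
    join_one _⟩

/-- The members of a continuous family of paths to `x₀` whose starting points vary openly are
well-targeted. -/
theorem wellTargeted_of_family {J : Type v} [TopologicalSpace J] {e : J → X} (he : IsOpenMap e)
    (γ : ∀ j, Path (e j) x₀) (h : Continuous fun p : J × I => γ p.1 p.2) (j : J) :
    WellTargeted (ofPath (γ j)) := by
  intro U hU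
  have h1 := (continuous_ofPath γ h).continuousAt.preimage_mem_nhds hU
  have h2 := he.image_mem_nhds h1
  have h3 : (ofPath (γ j)).1 0 = e j := (γ j).source
  rw [h3]
  filter_upwards [h2]
  rintro _ ⟨i, hi, rfl⟩
  exact ⟨_, hi, (γ i).source⟩

theorem locallyWellTargeted_of_family {J : Type v} [TopologicalSpace J] {e : J → X}
    (he : IsOpenMap e) (γ : ∀ j, Path (e j) x₀) (h : Continuous fun p : J × I => γ p.1 p.2)
    (j : J) : LocallyWellTargeted (ofPath (γ j)) := by
  intro U hU
  have h1 := (continuous_ofPath γ h).continuousAt.preimage_mem_nhds hU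
  have h2 := he.image_mem_nhds h1
  have h3 : (ofPath (γ j)).1 0 = e j := (γ j).source
  rw [h3]
  filter_upwards [h2]
  rintro _ ⟨i, hi, rfl⟩
  exact ⟨_, hi, wellTargeted_of_family he γ h i, (γ i).source⟩

/-- A neighborhood of the constant path contains all paths in some open neighborhood of `x₀`. -/
theorem exists_isOpen_of_mem_nhds_refl {U : Set (PathsTo x₀)}
    (hU : U ∈ 𝓝 (ofPath (Path.refl x₀))) :
    ∃ W : Set X, IsOpen W ∧ x₀ ∈ W ∧ ∀ β : PathsTo x₀, range β.1 ⊆ W → β ∈ U := by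
  obtain ⟨U', hU', hsub⟩ := (mem_nhds_subtype _ _ _).1 hU
  let l : Filter C(I, X) := (𝓝 x₀).lift' fun W => {α | range α ⊆ W}
  have hl : Tendsto id l (𝓝 (ofPath (Path.refl x₀)).1) := by
    rw [ContinuousMap.tendsto_nhds_compactOpen]
    intro K _ V hV hKV
    rcases K.eq_empty_or_nonempty with rfl | ⟨t, ht⟩
    · exact Eventually.of_forall fun α => mapsTo_empty _ _
    · have hx : V ∈ 𝓝 x₀ := hV.mem_nhds (hKV ht)
      filter_upwards [mem_lift' hx] with α hα s _
      exact hα (mem_range_self s)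
  have hmono : Monotone fun W : Set X => {α : C(I, X) | range α ⊆ W} :=
    fun _ _ h _ hα => Subset.trans hα h
  obtain ⟨W, hW, hWU⟩ := (mem_lift'_sets hmono).1 (hl hU')
  obtain ⟨W', hW'W, oW', mW'⟩ := mem_nhds_iff.1 hW
  exact ⟨W', oW', mW', fun β hβ => hsub (hWU (hβ.trans hW'W))⟩

/-- If small neighborhoods of `x₀` contain well-targeted paths from all nearby points other than
`x₀`, then the constant path is locally well-targeted. -/
theorem locallyWellTargeted_refl
    (h : ∀ W : Set X, IsOpen W → x₀ ∈ W → ∀ᶠ a in 𝓝 x₀, a ≠ x₀ →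
      ∃ γ : Path a x₀, range γ ⊆ W ∧ WellTargeted (ofPath γ)) :
    LocallyWellTargeted (ofPath (Path.refl x₀)) := by
  -- The local statement asks for a well-targeted path from `a = x₀` too, and the constant path
  -- serves there.
  have hwt : WellTargeted (ofPath (Path.refl x₀)) := by
    intro U hU
    obtain ⟨W, oW, mW, hW⟩ := exists_isOpen_of_mem_nhds_refl hU
    filter_upwards [h W oW mW] with a ha
    by_cases hax : a = x₀
    · exact ⟨_, mem_of_mem_nhds hU, hax.symm⟩
    · obtain ⟨γ, hγ, _⟩ := ha hax
      exact ⟨ofPath γ, hW _ hγ, γ.source⟩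
  intro U hU
  obtain ⟨W, oW, mW, hW⟩ := exists_isOpen_of_mem_nhds_refl hU
  filter_upwards [h W oW mW] with a ha
  by_cases hax : a = x₀
  · exact ⟨_, mem_of_mem_nhds hU, hwt, hax.symm⟩
  · obtain ⟨γ, hγ, hγ'⟩ := ha hax
    exact ⟨ofPath γ, hW _ hγ, hγ', γ.source⟩

theorem locallyWepConnected (h : ∀ x : X, ∃ γ : Path x x₀, LocallyWellTargeted (ofPath γ)) :
    LocallyWepConnected X := by
  intro x y
  obtain ⟨α, hα⟩ := h x
  obtain ⟨β, hβ⟩ := h y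
  exact ⟨_, hα.locallyWellEnded_join hβ, (join_zero _).trans α.source,
    (join_one _).trans β.source⟩

end PathsTo

end WellTargeted


/-! ### A subgroupoid of path classes determined by a subgroup -/

section ConjMem

variable {X : Type u} [TopologicalSpace X] {x₀ : X}

/-- The path class `g`, closed up to a loop at `x₀` by means of the paths `c`, lies in the
subgroup `N` of the fundamental group. -/
def ConjMem (N : Subgroup (FundamentalGroup X x₀)) (c : ∀ p, Path p x₀) (g : C(I, X)) : Prop :=
  FundamentalGroup.fromPath (.mk ((c (g 0)).symm.trans
    ((⟨g, rfl, rfl⟩ : Path (g 0) (g 1)).trans (c (g 1))))) ∈ N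

variable {N : Subgroup (FundamentalGroup X x₀)} {c : ∀ p, Path p x₀}

theorem conjMem_iff {p q : X} (ρ : Path p q) : ConjMem N c ρ.toContinuousMap ↔
    FundamentalGroup.fromPath (.mk ((c p).symm.trans (ρ.trans (c q)))) ∈ N := by
  obtain ⟨g, h0, h1⟩ := ρ
  subst h0 h1
  rfl

theorem ConjMem.congr {p q : X} {ρ η : Path p q} (h : ρ.Homotopic η)
    (hρ : ConjMem N c ρ.toContinuousMap) : ConjMem N c η.toContinuousMap := by
  rw [conjMem_iff] at *
  simp only [Path.Homotopic.Quotient.mk_trans] at *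
  rwa [← Path.Homotopic.Quotient.eq.2 h]

theorem ConjMem.trans {p q r : X} {ρ : Path p q} {η : Path q r}
    (hρ : ConjMem N c ρ.toContinuousMap) (hη : ConjMem N c η.toContinuousMap) :
    ConjMem N c (ρ.trans η).toContinuousMap := by
  rw [conjMem_iff] at *
  -- The product in the fundamental group traverses its right factor first, hence the reversed
  -- order.
  convert N.mul_mem hη hρ using 1
  rw [FundamentalGroup.mul_def]
  simp only [Path.Homotopic.Quotient.mk_trans, Path.Homotopic.Quotient.mk_symm,
    Path.Homotopic.Quotient.trans_assoc]
  rw [← Path.Homotopic.Quotient.trans_assoc (.mk (c q)), Path.Homotopic.Quotient.trans_symm,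
    Path.Homotopic.Quotient.refl_trans]

theorem ConjMem.symm {p q : X} {ρ : Path p q} (hρ : ConjMem N c ρ.toContinuousMap) :
    ConjMem N c ρ.symm.toContinuousMap := by
  rw [conjMem_iff] at *
  convert N.inv_mem hρ using 1
  rw [FundamentalGroup.inv_def]
  change _ = Path.Homotopic.Quotient.mk (Path.symm _)
  simp only [Path.trans_symm, Path.symm_symm]
  simp only [Path.Homotopic.Quotient.mk_trans, Path.Homotopic.Quotient.mk_symm,
    Path.Homotopic.Quotient.trans_assoc]

theorem conjMem_refl (p : X) : ConjMem N c (Path.refl p).toContinuousMap := by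
  rw [conjMem_iff]
  convert N.one_mem using 1
  rw [FundamentalGroup.one_def]
  simp only [Path.Homotopic.Quotient.mk_trans, Path.Homotopic.Quotient.mk_symm,
    Path.Homotopic.Quotient.mk_refl, Path.Homotopic.Quotient.refl_trans,
    Path.Homotopic.Quotient.symm_trans]

theorem ConjMem.of_trans_right {p q r : X} {ρ : Path p q} {η : Path q r}
    (h : ConjMem N c (ρ.trans η).toContinuousMap) (hη : ConjMem N c η.toContinuousMap) :
    ConjMem N c ρ.toContinuousMap := by
  refine (h.trans hη.symm).congr (Path.Homotopic.Quotient.eq.1 ?_)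
  simp only [Path.Homotopic.Quotient.mk_trans, Path.Homotopic.Quotient.mk_symm,
    Path.Homotopic.Quotient.trans_assoc, Path.Homotopic.Quotient.trans_symm,
    Path.Homotopic.Quotient.trans_refl]

/-- If `ConjMem` holds for three sides of a square, it holds for the fourth. -/
theorem ConjMem.of_square (K : C(I × I, X)) (h0 : ConjMem N c (K.comp (.prodMk (.id I) (.const I 0))))
    (h1 : ConjMem N c (K.comp (.prodMk (.id I) (.const I 1))))
    (ht : ConjMem N c (K.comp (.prodMk (.const I 1) (.id I)))) :
    ConjMem N c (K.comp (.prodMk (.const I 0) (.id I))) := by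
  let a0 : Path ((0, 0) : I × I) (1, 0) := ⟨.prodMk (.id I) (.const I 0), rfl, rfl⟩
  let a1 : Path ((0, 1) : I × I) (1, 1) := ⟨.prodMk (.id I) (.const I 1), rfl, rfl⟩
  let b0 : Path ((0, 0) : I × I) (0, 1) := ⟨.prodMk (.const I 0) (.id I), rfl, rfl⟩
  let b1 : Path ((1, 0) : I × I) (1, 1) := ⟨.prodMk (.const I 1) (.id I), rfl, rfl⟩
  have : ContractibleSpace I := (convex_Icc (0 : ℝ) 1).contractibleSpace ⟨0, by simp⟩
  -- The square is simply connected, so its two boundary routes between opposite corners are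
  -- homotopic.
  have hh : (a0.trans b1).Homotopic (b0.trans a1) := SimplyConnectedSpace.paths_homotopic _ _
  have h0' : ConjMem N c (a0.map K.continuous).toContinuousMap := h0
  have h1' : ConjMem N c (a1.map K.continuous).toContinuousMap := h1
  have ht' : ConjMem N c (b1.map K.continuous).toContinuousMap := ht
  change ConjMem N c (b0.map K.continuous).toContinuousMap
  refine ConjMem.of_trans_right ((h0'.trans ht').congr ?_) h1'
  rw [← Path.map_trans, ← Path.map_trans]
  exact hh.map K

/-- `ConjMem` can be checked on paths which are small of the order of an open cover. -/
theorem conjMem_of_cover {ι : Type v} (U : ι → Set X) (hU : ∀ i, IsOpen (U i))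
    (hc : ∀ x, ∃ i, x ∈ U i) (h : ∀ i (g : C(I, X)), range g ⊆ U i → ConjMem N c g) (g : C(I, X)) :
    ConjMem N c g := by
  -- A Lebesgue number subdivision; the pieces are then concatenated by induction.
  obtain ⟨t, ht0, hmono, ⟨n, hn⟩, ht⟩ := exists_monotone_Icc_subset_open_cover_unitInterval
    (c := fun i => g ⁻¹' U i) (fun i => (hU i).preimage g.continuous)
    (fun s _ => mem_iUnion.2 (hc (g s)))
  let ρ : Path (g 0) (g 1) := ⟨g, rfl, rfl⟩
  have key : ∀ m, ConjMem N c (ρ.subpath (t 0) (t m)).toContinuousMap := by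
    intro m
    induction m with
    | zero => rw [Path.subpath_self]; exact conjMem_refl _
    | succ m ih =>
      obtain ⟨i, hi⟩ := ht m
      have : ConjMem N c (ρ.subpath (t m) (t (m + 1))).toContinuousMap := by
        refine h i _ ?_
        change range (ρ.subpath (t m) (t (m + 1))) ⊆ U i
        rw [Path.range_subpath_of_le _ _ _ (hmono (Nat.le_succ m))]
        exact image_subset_iff.2 hi
      exact (ih.trans this).congr ⟨Path.Homotopy.subpathTransSubpath ρ _ _ _⟩
  have := key n
  rw [ht0, hn n le_rfl, Path.subpath_zero_one] at this
  exact this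

end ConjMem

/-! ### Adjunction spaces -/

/-- The adjunction space `B ∪_φ C`, where `φ` maps the subset `S` of `C` to `B`. -/
def Adj {B : Type u} {C : Type v} (S : Set C) (_ : C → B) : Type (max u v) :=
  B ⊕ {c // c ∉ S}

namespace Adj

variable {B : Type u} {C : Type v} {S : Set C} {φ : C → B}

/-- The inclusion of the base in an adjunction space. -/
def base (b : B) : Adj S φ := Sum.inl b

/-- The inclusion of `C ∖ S` in the adjunction space. -/
def cell (c : {c // c ∉ S}) : Adj S φ := Sum.inr c

open Classical in
/-- The characteristic map of an adjunction space. -/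
noncomputable def char (c : C) : Adj S φ := if h : c ∈ S then base (φ c) else cell ⟨c, h⟩

theorem char_of_mem {c : C} (h : c ∈ S) : (char c : Adj S φ) = base (φ c) := dif_pos h

theorem char_of_notMem {c : C} (h : c ∉ S) : (char c : Adj S φ) = cell ⟨c, h⟩ := dif_neg h

theorem char_coe (c : {c // c ∉ S}) : (char c.1 : Adj S φ) = cell c := char_of_notMem c.2

theorem base_ne_cell (b : B) (c : {c // c ∉ S}) : (base b : Adj S φ) ≠ cell c := nofun

theorem cell_injective : Function.Injective (cell : {c // c ∉ S} → Adj S φ) := Sum.inr_injective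

/-- The map out of an adjunction space determined by maps on the base and on `C`. -/
def desc {T : Type w} (f : B → T) (g : C → T) : Adj S φ → T :=
  Sum.elim f fun c => g c.1

theorem desc_char {T : Type w} {f : B → T} {g : C → T} (h : ∀ c ∈ S, g c = f (φ c)) (c : C) :
    desc f g (char c : Adj S φ) = g c := by
  by_cases hc : c ∈ S
  · rw [char_of_mem hc, h c hc]; rfl
  · rw [char_of_notMem hc]; rfl

variable [TopologicalSpace B] [TopologicalSpace C]

noncomputable instance : TopologicalSpace (Adj S φ) :=
  .coinduced (Sum.elim base char) inferInstance

theorem isQuotientMap : IsQuotientMap (Sum.elim base char : B ⊕ C → Adj S φ) := by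
  refine ⟨⟨rfl⟩, ?_⟩
  rintro (b | c)
  · exact ⟨.inl b, rfl⟩
  · exact ⟨.inr c.1, char_coe c⟩

theorem isOpen_iff {U : Set (Adj S φ)} :
    IsOpen U ↔ IsOpen (base ⁻¹' U) ∧ IsOpen (char ⁻¹' U) := by
  rw [← isQuotientMap.isOpen_preimage, isOpen_sum_iff]
  rfl

theorem continuous_base : Continuous (base : B → Adj S φ) :=
  isQuotientMap.continuous.comp continuous_inl

theorem continuous_char : Continuous (char : C → Adj S φ) :=
  isQuotientMap.continuous.comp continuous_inr

theorem continuous_iff {T : Type w} [TopologicalSpace T] {f : Adj S φ → T} :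
    Continuous f ↔ Continuous (f ∘ base) ∧ Continuous (f ∘ char) := by
  rw [isQuotientMap.continuous_iff, continuous_sum_dom]
  rfl

/-- A quotient map restricts to a quotient map over an open set, so continuity there can be tested
on the two pieces. -/
theorem continuousOn_of_isOpen {T : Type w} [TopologicalSpace T] {f : Adj S φ → T}
    {V : Set (Adj S φ)} (hV : IsOpen V) (hb : ContinuousOn (f ∘ base) (base ⁻¹' V))
    (hc : ContinuousOn (f ∘ char) (char ⁻¹' V)) : ContinuousOn f V := by
  rw [isQuotientMap.continuousOn_isOpen_iff hV,
    (hV.preimage isQuotientMap.continuous).continuousOn_iff]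
  rintro (b | c) h
  · exact IsOpenEmbedding.inl.continuousAt_iff.1
      (hb.continuousAt ((hV.preimage continuous_base).mem_nhds h))
  · exact IsOpenEmbedding.inr.continuousAt_iff.1
      (hc.continuousAt ((hV.preimage continuous_char).mem_nhds h))

theorem isOpenMap_cell (hS : IsClosed S) : IsOpenMap (cell : {c // c ∉ S} → Adj S φ) := by
  intro U hU
  rw [isOpen_iff]
  constructor
  · convert isOpen_empty
    ext b
    simp [(base_ne_cell b _).symm]
  · convert hS.isOpen_compl.isOpenMap_subtype_val U hU using 1
    ext c
    by_cases h : c ∈ S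
    · simp [char_of_mem h, (base_ne_cell _ _).symm, h]
    · simp [char_of_notMem h, cell_injective.eq_iff, h]

theorem continuous_cell : Continuous (cell : {c // c ∉ S} → Adj S φ) :=
  (continuous_char.comp continuous_subtype_val).congr char_coe

theorem isOpenEmbedding_cell (hS : IsClosed S) :
    IsOpenEmbedding (cell : {c // c ∉ S} → Adj S φ) :=
  .of_continuous_injective_isOpenMap continuous_cell cell_injective (isOpenMap_cell hS)

theorem continuous_desc {T : Type w} [TopologicalSpace T] {f : B → T} {g : C → T}
    (hf : Continuous f) (hg : Continuous g) (h : ∀ c ∈ S, g c = f (φ c)) :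
    Continuous (desc f g : Adj S φ → T) :=
  continuous_iff.2 ⟨hf, hg.congr fun c => (desc_char h c).symm⟩

end Adj


/-! ### The wedge of circles parametrized by a space -/

noncomputable section LoopWedge

/-- The quotient of `Z × I` in which `Z × {0, 1}` is collapsed to a point. -/
abbrev LoopWedge (Z : Type u) : Type u :=
  Adj {c : Z × I | c.2 = 0 ∨ c.2 = 1} fun _ => PUnit.unit.{u + 1}

namespace LoopWedge

variable {Z : Type u}

/-- The point of `LoopWedge Z` to which the ends are collapsed. -/
def pt : LoopWedge Z := Adj.base PUnit.unit

theorem char_eq_pt {c : Z × I} (h : c.2 = 0 ∨ c.2 = 1) : (Adj.char c : LoopWedge Z) = pt :=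
  Adj.char_of_mem h

theorem char_eq_cell {c : Z × I} (h : ¬(c.2 = 0 ∨ c.2 = 1)) :
    (Adj.char c : LoopWedge Z) = Adj.cell ⟨c, h⟩ :=
  Adj.char_of_notMem (S := {c : Z × I | c.2 = 0 ∨ c.2 = 1}) h

variable [TopologicalSpace Z]

theorem isClosed_ends : IsClosed {c : Z × I | c.2 = 0 ∨ c.2 = 1} :=
  (isClosed_eq continuous_snd continuous_const).union (isClosed_eq continuous_snd continuous_const)

/-- The path along its circle from the point with parameters `c` to the one with parameter `e`. -/
def slideChar (e : I) (c : Z × I) : C(I, LoopWedge Z) :=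
  ⟨fun s => Adj.char (c.1, Icc.convexComb c.2 e s),
    Adj.continuous_char.comp (continuous_const.prodMk
      (Icc.continuous_convexComb_prod.comp
      (by fun_prop : Continuous fun s : I => (c.2, e, s))))⟩

theorem continuous_slideChar (e : I) :
    Continuous (slideChar e : Z × I → C(I, LoopWedge Z)) := by
  refine ContinuousMap.continuous_of_continuous_uncurry _ ?_
  exact Adj.continuous_char.comp (.prodMk (by fun_prop)
    (Icc.continuous_convexComb_prod.comp
      (by fun_prop : Continuous fun p : (Z × I) × I => (p.1.2, e, p.2))))

/-- The path from a point of `LoopWedge Z` along its circle in the direction of the parameter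
`e`. -/
def slide (e : I) : LoopWedge Z → C(I, LoopWedge Z) :=
  Adj.desc (fun _ => .const I pt) (slideChar e)

theorem slide_zero (e : I) (x : LoopWedge Z) : slide e x 0 = x := by
  rcases x with _ | c
  · rfl
  · change Adj.char (c.1.1, Icc.convexComb c.1.2 e 0) = _
    rw [Icc.convexComb_zero]
    exact Adj.char_coe c

theorem slide_one {e : I} (he : e = 0 ∨ e = 1) (x : LoopWedge Z) : slide e x 1 = pt := by
  rcases x with _ | c
  · rfl
  · change Adj.char (c.1.1, Icc.convexComb c.1.2 e 1) = _
    rw [Icc.convexComb_one]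
    exact char_eq_pt he

theorem isOpen_ne_pt : IsOpen {x : LoopWedge Z | x ≠ pt} := by
  rw [Adj.isOpen_iff]
  constructor
  · convert isOpen_empty
    ext ⟨⟩
    simp [pt]
  · convert (isClosed_ends (Z := Z)).isOpen_compl
    ext c
    by_cases h : c.2 = 0 ∨ c.2 = 1
    · simp [char_eq_pt h, h]
    · rw [mem_preimage, char_eq_cell h]
      exact ⟨fun _ => h, fun _ => (Adj.base_ne_cell _ _).symm⟩

/-- Continuity can fail at `pt`: points near the end opposite to `e` slide around almost the whole
circle. -/
theorem continuousOn_slide (e : I) :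
    ContinuousOn (slide e : LoopWedge Z → C(I, LoopWedge Z)) {x | x ≠ pt} := by
  refine Adj.continuousOn_of_isOpen isOpen_ne_pt ?_ ?_
  · rintro ⟨⟩ h
    exact absurd rfl h
  · refine (continuous_slideChar e).continuousOn.congr fun c hc => ?_
    have h : ¬(c.2 = 0 ∨ c.2 = 1) := fun h => hc (char_eq_pt h)
    change slide e (Adj.char c) = _
    rw [char_eq_cell h]
    rfl

/-- The path from a point to the base point in the direction of `e ∈ {0, 1}`. -/
def slidePath {e : I} (he : e = 0 ∨ e = 1) (x : LoopWedge Z) : Path x pt :=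
  ⟨slide e x, slide_zero e x, slide_one he x⟩

/-- The points of `W` which can be slid to the base point inside `W`. -/
theorem isOpen_slide_subset {W : Set (LoopWedge Z)} (hW : IsOpen W) (hpt : pt ∈ W) :
    IsOpen {x : LoopWedge Z | range (slide 0 x) ⊆ W ∨ range (slide 1 x) ⊆ W} := by
  rw [Adj.isOpen_iff]
  constructor
  · exact isOpen_discrete _
  · have h : ∀ e : I, IsOpen {c : Z × I | range (slideChar e c) ⊆ W} := fun e =>
      (ContinuousMap.isOpen_setOfPred_range_subset hW).preimage (continuous_slideChar e)
    convert (h 0).union (h 1) using 1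
    ext c
    by_cases hc : c.2 = 0 ∨ c.2 = 1
    · rw [mem_preimage, char_eq_pt hc]
      refine iff_of_true (Or.inl (range_subset_iff.2 fun _ => hpt)) ?_
      -- A parameter already equal to `0` or `1` does not move when slid towards that same end.
      refine hc.imp (fun h => range_subset_iff.2 fun s => ?_)
        (fun h => range_subset_iff.2 fun s => ?_)
      all_goals
        change Adj.char (c.1, Icc.convexComb c.2 _ s) ∈ W
        rw [h, Icc.convexComb_eq, char_eq_pt (by simp)]
        exact hpt
    · rw [mem_preimage, char_eq_cell hc]
      rfl

end LoopWedge

end LoopWedge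


/-! ### The disc and its radial projection -/

noncomputable section Disc

/-- The closed unit ball of `ℝ × ℝ` with the supremum norm. -/
abbrev Disc : Type := Metric.closedBall (0 : ℝ × ℝ) 1

namespace Disc

instance : ContractibleSpace Disc :=
  (convex_closedBall (0 : ℝ × ℝ) 1).contractibleSpace ⟨0, by simp⟩

/-- A point of the boundary of the disc. -/
def east : Disc := ⟨(1, 0), by simp⟩

theorem norm_east : ‖east.1‖ = 1 := by simp [east]

/-- The straight path between two points of the disc. -/
def seg (e e' : Disc) : Path e e' where
  toFun s := ⟨AffineMap.lineMap e.1 e'.1 (s : ℝ),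
    (convex_closedBall (0 : ℝ × ℝ) 1).lineMap_mem e.2 e'.2 s.2⟩
  continuous_toFun := by
    refine Continuous.subtype_mk ?_ _
    simp only [AffineMap.lineMap_apply_module]
    fun_prop
  source' := by simp
  target' := by simp

theorem continuous_seg :
    Continuous fun p : Disc × Disc => (seg p.1 p.2).toContinuousMap := by
  refine ContinuousMap.continuous_of_continuous_uncurry _ (Continuous.subtype_mk ?_ _)
  simp only [AffineMap.lineMap_apply_module]
  fun_prop

theorem seg_self (e : Disc) : seg e e = Path.refl e := by
  ext s : 2
  simp [seg]

/-- The radial projection of the disc to its boundary. -/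
def proj (e : Disc) : Disc :=
  if h : e.1 = 0 then east else ⟨‖e.1‖⁻¹ • e.1, by simp [norm_smul, norm_ne_zero_iff.2 h]⟩

theorem norm_proj (e : Disc) : ‖(proj e).1‖ = 1 := by
  unfold proj
  split_ifs with h
  · exact norm_east
  · simp [norm_smul, norm_ne_zero_iff.2 h]

theorem proj_of_norm {e : Disc} (h : ‖e.1‖ = 1) : proj e = e := by
  have : e.1 ≠ 0 := by
    intro h0
    simp [h0] at h
  ext1
  simp [proj, this, h]

theorem continuousOn_proj : ContinuousOn proj {e | e.1 ≠ 0} := by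
  rw [IsInducing.subtypeVal.continuousOn_iff]
  have : ContinuousOn (fun e : Disc => ‖e.1‖⁻¹ • e.1) {e | e.1 ≠ 0} :=
    ContinuousOn.smul (ContinuousOn.inv₀ (by fun_prop) fun e he => norm_ne_zero_iff.2 he)
      (by fun_prop)
  refine this.congr fun e he => ?_
  simp only [mem_ofPred_eq] at he
  simp [proj, he]

theorem continuousOn_seg_proj :
    ContinuousOn (fun e : Disc => (seg e (proj e)).toContinuousMap) {e | e.1 ≠ 0} := by
  have h0 : ContinuousOn (fun e : Disc => (e, proj e)) {e : Disc | e.1 ≠ 0} :=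
    continuousOn_id.prodMk continuousOn_proj
  have := continuous_seg.comp_continuousOn h0
  exact this

/-- A path in the disc with endpoints on the boundary is homotopic to a path in the boundary. -/
theorem exists_homotopic_norm_eq_one {e e' : Disc} (he : ‖e.1‖ = 1) (he' : ‖e'.1‖ = 1)
    (η : Path e e') : ∃ η' : Path e e', (∀ t, ‖(η' t).1‖ = 1) ∧ η.Homotopic η' := by
  -- Spheres are path connected in real dimension above one; any boundary path then works, the disc
  -- being simply connected.
  have hrank : 1 < Module.rank ℝ (ℝ × ℝ) := by simp; norm_num
  obtain ⟨ρ, hρ⟩ := (isPathConnected_sphere hrank (0 : ℝ × ℝ) zero_le_one).joinedIn e.1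
    (by simpa using he) e'.1 (by simpa using he')
  simp only [mem_sphere_iff_norm, sub_zero] at hρ
  refine ⟨⟨⟨fun t => ⟨ρ t, by simp [hρ]⟩, by fun_prop⟩, by ext1; simp, by ext1; simp⟩, hρ, ?_⟩
  exact SimplyConnectedSpace.paths_homotopic _ _

end Disc

end Disc

/-! ### Attaching discs and retracting off their centers -/

noncomputable section CellAttachment

theorem continuousOn_sigma {K : Type u} {D : K → Type v} [∀ k, TopologicalSpace (D k)] {T : Type w}
    [TopologicalSpace T] {f : (Σ k, D k) → T} {V : Set (Σ k, D k)}
    (h : ∀ k, ContinuousOn (fun e => f ⟨k, e⟩) (Sigma.mk k ⁻¹' V)) : ContinuousOn f V := by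
  rintro ⟨k, e⟩ he
  rw [ContinuousWithinAt, ← IsOpenEmbedding.sigmaMk.map_nhdsWithin_preimage_eq, tendsto_map'_iff]
  exact h k e he

/-- The boundary of the disjoint union of the discs indexed by `K`. -/
def discBoundary (K : Type v) : Set (Σ _ : K, Disc) := {c | ‖c.2.1‖ = 1}

theorem isClosed_discBoundary (K : Type v) : IsClosed (discBoundary K) :=
  isClosed_eq (continuous_sigma fun _ => by fun_prop) continuous_const

/-- The space obtained from `B` by attaching discs along their boundaries by means of `φ`. -/
abbrev AttachDiscs {B : Type u} {K : Type v} (φ : (Σ _ : K, Disc) → B) : Type (max u v) :=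
  Adj (discBoundary K) φ

namespace AttachDiscs

variable {B : Type u} {K : Type v} [TopologicalSpace B] {φ : (Σ _ : K, Disc) → B}

/-- The characteristic map of a disc. -/
def discMap (k : K) : C(Disc, AttachDiscs φ) :=
  ⟨fun e => Adj.char ⟨k, e⟩, Adj.continuous_char.comp continuous_sigmaMk⟩

theorem discMap_of_norm {k : K} {e : Disc} (h : ‖e.1‖ = 1) :
    (discMap k e : AttachDiscs φ) = Adj.base (φ ⟨k, e⟩) := Adj.char_of_mem h

/-- The complement of the centers of the attached discs. -/
def Punctured : Set (AttachDiscs φ) :=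
  {x | Adj.desc (fun _ => True) (fun c => c.2.1 ≠ 0) x}

theorem discMap_mem_punctured {k : K} {e : Disc} :
    (discMap k e : AttachDiscs φ) ∈ Punctured ↔ e.1 ≠ 0 := by
  have h : ∀ c ∈ discBoundary K, (c.2.1 ≠ 0) = True := fun c hc => eq_true fun h => by
    simp [discBoundary, h] at hc
  have := Adj.desc_char (φ := φ) (f := fun _ => True) h ⟨k, e⟩
  exact iff_of_eq this

theorem isOpen_punctured : IsOpen (Punctured : Set (AttachDiscs φ)) := by
  rw [Adj.isOpen_iff]
  constructor
  · exact isOpen_univ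
  · have : IsOpen {c : Σ _ : K, Disc | c.2.1 ≠ 0} :=
      isOpen_ne_fun (continuous_sigma fun _ => by fun_prop) continuous_const
    convert this using 1
    ext c
    exact discMap_mem_punctured (φ := φ)

/-- The radial path from a point to the base. -/
def radial : AttachDiscs φ → C(I, AttachDiscs φ) :=
  Adj.desc (fun b => .const I (Adj.base b))
    fun c => (discMap c.1).comp (Disc.seg c.2 (Disc.proj c.2)).toContinuousMap

/-- The radial retraction to the base. -/
def retr : AttachDiscs φ → B :=
  Adj.desc id fun c => φ ⟨c.1, Disc.proj c.2⟩

theorem radial_zero (x : AttachDiscs φ) : radial x 0 = x := by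
  rcases x with _ | c
  · rfl
  · change discMap _ (Disc.seg _ _ 0) = _
    rw [Path.source]
    exact Adj.char_coe c

theorem radial_one (x : AttachDiscs φ) : radial x 1 = Adj.base (retr x) := by
  rcases x with _ | c
  · rfl
  · change discMap _ (Disc.seg _ _ 1) = _
    rw [Path.target]
    exact discMap_of_norm (Disc.norm_proj _)

theorem radial_discMap (k : K) (e : Disc) : radial (discMap k e : AttachDiscs φ) =
    (discMap k).comp (Disc.seg e (Disc.proj e)).toContinuousMap := by
  have h : ∀ c ∈ discBoundary K,
      (discMap c.1 : C(Disc, AttachDiscs φ)).comp (Disc.seg c.2 (Disc.proj c.2)).toContinuousMap =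
        .const I (Adj.base (φ c)) := by
    intro c hc
    rw [Disc.proj_of_norm hc, Disc.seg_self]
    ext
    exact discMap_of_norm hc
  exact Adj.desc_char (φ := φ)
    (f := fun b => ContinuousMap.const I (Adj.base b : AttachDiscs φ)) h ⟨k, e⟩

theorem retr_discMap (k : K) (e : Disc) :
    retr (discMap k e : AttachDiscs φ) = φ ⟨k, Disc.proj e⟩ := by
  have h : ∀ c ∈ discBoundary K, φ ⟨c.1, Disc.proj c.2⟩ = id (φ c) := by
    intro c hc
    rw [Disc.proj_of_norm hc]
    rfl
  exact Adj.desc_char h ⟨k, e⟩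

theorem continuousOn_radial :
    ContinuousOn (radial : AttachDiscs φ → C(I, AttachDiscs φ)) Punctured := by
  refine Adj.continuousOn_of_isOpen isOpen_punctured ?_ (continuousOn_sigma fun k => ?_)
  · have h : Continuous fun b : B => ContinuousMap.const I (Adj.base b : AttachDiscs φ) :=
      ContinuousMap.continuous_const'.comp Adj.continuous_base
    exact h.continuousOn
  · have h2 := (discMap k : C(Disc, AttachDiscs φ)).continuous_postcomp.comp_continuousOn
      Disc.continuousOn_seg_proj
    exact (h2.mono fun e he => (discMap_mem_punctured (φ := φ)).1 he).congr
      fun e _ => radial_discMap k e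

theorem continuousOn_retr (hφ : ∀ k, ContinuousOn (fun e => φ ⟨k, e⟩) {e | ‖e.1‖ = 1}) :
    ContinuousOn (retr : AttachDiscs φ → B) Punctured := by
  refine Adj.continuousOn_of_isOpen isOpen_punctured ?_ (continuousOn_sigma fun k => ?_)
  · exact continuousOn_id
  · have h2 := (hφ k).comp Disc.continuousOn_proj fun e _ => Disc.norm_proj e
    exact (h2.mono fun e he => (discMap_mem_punctured (φ := φ)).1 he).congr
      fun e _ => retr_discMap k e

end AttachDiscs

end CellAttachment


/-! ### Deforming loops into the base -/

noncomputable section CellAttachmentLoops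

namespace AttachDiscs

variable {B : Type u} {K : Type v} [TopologicalSpace B] {φ : (Σ _ : K, Disc) → B} {b₀ : B}

/-- The path from a point of the interior of a disc to its `east` point. -/
def cellPath (c : {c // c ∉ discBoundary K}) :
    Path (Adj.cell c : AttachDiscs φ) (Adj.base (φ ⟨c.1.1, Disc.east⟩)) :=
  ((Disc.seg c.1.2 Disc.east).map (discMap c.1.1).continuous).cast (Adj.char_coe c).symm
    (discMap_of_norm Disc.norm_east).symm

/-- A path in the base, regarded as a path in the space with the discs attached. -/
abbrev basePath {b b' : B} (γ : Path b b') : Path (Adj.base b : AttachDiscs φ) (Adj.base b') :=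
  γ.map Adj.continuous_base

/-- Paths from all points to the base point. -/
def toBasePoint (c : ∀ b, Path b b₀) : ∀ p : AttachDiscs φ, Path p (Adj.base b₀)
  | .inl b => basePath (c b)
  | .inr e => (cellPath e).trans (basePath (c _))

variable (φ b₀) in
/-- The image of the fundamental group of the base. -/
def baseSubgroup : Subgroup (FundamentalGroup (AttachDiscs φ) (Adj.base b₀)) :=
  (FundamentalGroup.map ⟨Adj.base, Adj.continuous_base⟩ b₀).range

variable (c : ∀ b, Path b b₀)

theorem conjMem_base (g : C(I, B)) :
    ConjMem (baseSubgroup φ b₀) (toBasePoint c)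
      ((⟨Adj.base, Adj.continuous_base⟩ : C(B, AttachDiscs φ)).comp g) := by
  let η : Path (g 0) (g 1) := ⟨g, rfl, rfl⟩
  change ConjMem _ _ (basePath η).toContinuousMap
  rw [conjMem_iff]
  refine ⟨FundamentalGroup.fromPath (.mk ((c _).symm.trans (η.trans (c _)))), ?_⟩
  change Path.Homotopic.Quotient.mk (Path.map _ _) = _
  rw [Path.map_trans, Path.map_trans, ← Path.map_symm]
  rfl

/-- `toBasePoint` starts at an interior point with this very path, so the closed-up loop is
null-homotopic. -/
theorem conjMem_cellPath (e : {c // c ∉ discBoundary K}) :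
    ConjMem (baseSubgroup φ b₀) (toBasePoint c) (cellPath e : Path (_ : AttachDiscs φ) _) := by
  change ConjMem _ _ (cellPath e).toContinuousMap
  rw [conjMem_iff]
  convert Subgroup.one_mem _ using 1
  exact Path.Homotopic.Quotient.eq.2 ⟨(Path.Homotopy.reflSymmTrans _).symm⟩

/-- The disc is simply connected, so a path in it may be compared with segments to `east`. Such a
segment is either a `cellPath` or joins boundary points, and in the latter case it deforms into the
boundary, which lies in the base. -/
theorem conjMem_disc (k : K) (g : C(I, Disc))
    (hφ : ∀ k, ContinuousOn (fun e => φ ⟨k, e⟩) {e | ‖e.1‖ = 1}) :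
    ConjMem (baseSubgroup φ b₀) (toBasePoint c) ((discMap k : C(Disc, AttachDiscs φ)).comp g) := by
  have hbd : ∀ {e e' : Disc} (η : Path e e'), ‖e.1‖ = 1 → ‖e'.1‖ = 1 →
      ConjMem (baseSubgroup φ b₀) (toBasePoint c)
        (η.map (discMap k : C(Disc, AttachDiscs φ)).continuous).toContinuousMap := by
    intro e e' η he he'
    obtain ⟨η', hη', hh⟩ := Disc.exists_homotopic_norm_eq_one he he' η
    refine ConjMem.congr (hh.symm.map (discMap k)) ?_
    have hcont : Continuous fun t => φ ⟨k, η' t⟩ :=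
      (hφ k).comp_continuous η'.continuous hη'
    convert conjMem_base c ⟨fun t => φ ⟨k, η' t⟩, hcont⟩ using 1
    ext t
    exact discMap_of_norm (hη' t)
  have heast : ∀ e : Disc, ConjMem (baseSubgroup φ b₀) (toBasePoint c)
      ((Disc.seg e Disc.east).map (discMap k : C(Disc, AttachDiscs φ)).continuous).toContinuousMap
      := by
    intro e
    by_cases he : ‖e.1‖ = 1
    · exact hbd _ he Disc.norm_east
    · exact conjMem_cellPath c ⟨⟨k, e⟩, he⟩
  let η : Path (g 0) (g 1) := ⟨g, rfl, rfl⟩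
  change ConjMem _ _ (η.map (discMap k : C(Disc, AttachDiscs φ)).continuous).toContinuousMap
  refine ConjMem.of_trans_right ((heast (g 0)).congr ?_) (heast (g 1))
  rw [← Path.map_trans]
  exact (SimplyConnectedSpace.paths_homotopic (Disc.seg (g 0) Disc.east)
    (η.trans (Disc.seg (g 1) Disc.east))).map (discMap k)

theorem conjMem_of_range_subset_cell (g : C(I, AttachDiscs φ)) (hg : range g ⊆ range Adj.cell)
    (hφ : ∀ k, ContinuousOn (fun e => φ ⟨k, e⟩) {e | ‖e.1‖ = 1}) :
    ConjMem (baseSubgroup φ b₀) (toBasePoint c) g := by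
  have hemb := Adj.isOpenEmbedding_cell (φ := φ) (isClosed_discBoundary K)
  choose l hl using fun t => hg (mem_range_self t)
  have hcont : Continuous l := by
    rw [hemb.isInducing.continuous_iff]
    exact g.continuous.congr fun t => (hl t).symm
  -- By connectedness of `I` the path stays in a single disc.
  obtain ⟨k, m, hm⟩ := ContinuousMap.exists_lift_sigma
    (⟨fun t => (l t).1, continuous_subtype_val.comp hcont⟩ : C(I, Σ _ : K, Disc))
  convert conjMem_disc c k m hφ using 1
  ext t
  rw [← hl t, ← Adj.char_coe]
  exact congrArg Adj.char (DFunLike.congr_fun hm t)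

theorem conjMem_radial (hφ : ∀ k, ContinuousOn (fun e => φ ⟨k, e⟩) {e | ‖e.1‖ = 1})
    (x : AttachDiscs φ) : ConjMem (baseSubgroup φ b₀) (toBasePoint c) (radial x) := by
  rcases x with b | e
  · exact conjMem_refl (Adj.base b)
  · exact conjMem_disc c _ _ hφ

theorem conjMem_of_range_subset_punctured (g : C(I, AttachDiscs φ)) (hg : range g ⊆ Punctured)
    (hφ : ∀ k, ContinuousOn (fun e => φ ⟨k, e⟩) {e | ‖e.1‖ = 1}) :
    ConjMem (baseSubgroup φ b₀) (toBasePoint c) g := by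
  have hmem : ∀ t, g t ∈ Punctured := fun t => hg (mem_range_self t)
  have hrad : Continuous fun t => radial (g t) :=
    continuousOn_radial.comp_continuous g.continuous hmem
  have hK : Continuous fun p : I × I => radial (g p.2) p.1 := by
    have : Continuous fun p : I × I => radial (g p.2) := hrad.comp continuous_snd
    exact this.eval continuous_fst
  -- The radial paths sweep out a square whose side at `0` is `g`, whose side at `1` lies in the
  -- base, and whose other two sides are radial.
  let Q : C(I × I, AttachDiscs φ) := ⟨_, hK⟩
  have h0 : ∀ t, Q.comp (.prodMk (.id I) (.const I t)) = radial (g t) := fun t => rfl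
  have h1 : Q.comp (.prodMk (.const I 1) (.id I)) =
      (⟨Adj.base, Adj.continuous_base⟩ : C(B, AttachDiscs φ)).comp
        ⟨fun t => retr (g t), (continuousOn_retr hφ).comp_continuous g.continuous hmem⟩ := by
    ext t
    exact radial_one (g t)
  have h2 : Q.comp (.prodMk (.const I 0) (.id I)) = g := by
    ext t
    exact radial_zero (g t)
  rw [← h2]
  refine ConjMem.of_square Q ?_ ?_ ?_
  · rw [h0]; exact conjMem_radial c hφ _
  · rw [h0]; exact conjMem_radial c hφ _
  · rw [h1]; exact conjMem_base c _

/-- Every loop in a space obtained by attaching discs to a path connected space is homotopic to a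
loop in the base. -/
theorem exists_homotopic_basePath (hφ : ∀ k, ContinuousOn (fun e => φ ⟨k, e⟩) {e | ‖e.1‖ = 1})
    (c : ∀ b, Path b b₀) (δ : Path (Adj.base b₀ : AttachDiscs φ) (Adj.base b₀)) :
    ∃ γ : Path b₀ b₀, δ.Homotopic (basePath γ) := by
  have hδ : ConjMem (baseSubgroup φ b₀) (toBasePoint c) δ.toContinuousMap := by
    refine conjMem_of_cover (fun i : Bool => if i then Punctured else range Adj.cell) ?_ ?_ ?_ _
    · rintro (_ | _)
      · exact (Adj.isOpenEmbedding_cell (isClosed_discBoundary K)).isOpen_range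
      · exact isOpen_punctured
    · rintro (b | e)
      · exact ⟨true, trivial⟩
      · exact ⟨false, e, rfl⟩
    · rintro (_ | _) g hg
      · exact conjMem_of_range_subset_cell c g hg hφ
      · exact conjMem_of_range_subset_punctured c g hg hφ
  rw [conjMem_iff] at hδ
  obtain ⟨a, ha⟩ := hδ
  obtain ⟨γ, rfl⟩ := Path.Homotopic.Quotient.mk_surjective a
  -- The loop `c b₀` need not be constant, so the conjugation by it is undone within the base.
  refine ⟨(c b₀).trans (γ.trans (c b₀).symm), Path.Homotopic.Quotient.eq.1 ?_⟩
  have ha' : Path.Homotopic.Quotient.mk (basePath γ) = Path.Homotopic.Quotient.mk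
      ((basePath (c b₀)).symm.trans (δ.trans (basePath (c b₀)))) := ha
  rw [basePath, Path.map_trans, Path.map_trans, ← Path.map_symm]
  simp only [Path.Homotopic.Quotient.mk_trans] at ha' ⊢
  rw [ha']
  simp only [Path.Homotopic.Quotient.mk_symm, Path.Homotopic.Quotient.trans_assoc,
    Path.Homotopic.Quotient.trans_symm, Path.Homotopic.Quotient.trans_refl]
  rw [← Path.Homotopic.Quotient.trans_assoc, Path.Homotopic.Quotient.trans_symm,
    Path.Homotopic.Quotient.refl_trans]

end AttachDiscs

end CellAttachmentLoops


/-! ### Local wep-connectedness after attaching discs -/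

theorem Adj.isOpen_char_image {B : Type u} {C : Type v} {S : Set C} {φ : C → B} [TopologicalSpace B]
    [TopologicalSpace C] (hS : IsClosed S) {V : Set C} (hV : IsOpen V) (hVS : V ⊆ Sᶜ) :
    IsOpen (Adj.char '' V : Set (Adj S φ)) := by
  convert Adj.isOpenMap_cell hS _ (hV.preimage continuous_subtype_val) using 1
  ext x
  constructor
  · rintro ⟨c, hc, rfl⟩
    exact ⟨⟨c, hVS hc⟩, hc, (Adj.char_coe _).symm⟩
  · rintro ⟨c, hc, rfl⟩
    exact ⟨c.1, hc, Adj.char_coe c⟩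

noncomputable section CellAttachmentWep

namespace AttachDiscs

open PathsTo

section

variable {B : Type u} {K : Type v} [TopologicalSpace B] {φ : (Σ _ : K, Disc) → B}
  {x₀ : AttachDiscs φ}

/-- A path that starts in the interior of a disc with a straight segment of that disc is
well-targeted and locally well-targeted. -/
theorem wellTargeted_of_seg {k : K} {e e' : Disc} (he : ‖e.1‖ ≠ 1) {x z : AttachDiscs φ}
    (q : Path x z) (hq : ∀ t, q t = discMap k (Disc.seg e e' t)) (p : Path z x₀) :
    WellTargeted (ofPath (q.trans p)) ∧ LocallyWellTargeted (ofPath (q.trans p)) := by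
  obtain rfl : x = discMap k e := by rw [← q.source, hq, Path.source]
  obtain rfl : z = discMap k e' := by rw [← q.target, hq, Path.target]
  obtain rfl : q = (Disc.seg e e').map (discMap k).continuous := by
    ext t
    exact hq t
  let v (j : {e : Disc // ‖e.1‖ ≠ 1}) : AttachDiscs φ := discMap k j.1
  have hopen : IsOpen {e : Disc | ‖e.1‖ ≠ 1} := isOpen_ne_fun (by fun_prop) continuous_const
  have hv : IsOpenMap v := by
    intro U hU
    have h0 : IsOpenMap (fun a : Disc => (⟨k, a⟩ : Σ _ : K, Disc)) :=
      @isOpenMap_sigmaMk K (fun _ => Disc) _ k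
    have h1 := h0 _ (hopen.isOpenMap_subtype_val U hU)
    convert Adj.isOpen_char_image (φ := φ) (isClosed_discBoundary K) h1 ?_ using 1
    · rw [image_image, image_image]
      rfl
    · rintro _ ⟨_, ⟨j, _, rfl⟩, rfl⟩
      exact j.2
  let γ (j : {e : Disc // ‖e.1‖ ≠ 1}) : Path (v j) x₀ :=
    ((Disc.seg j.1 e').map (discMap k).continuous).trans p
  have hγ : Continuous fun r : {e : Disc // ‖e.1‖ ≠ 1} × I => γ r.1 r.2 := by
    refine Path.trans_continuous_family
      (fun j : {e : Disc // ‖e.1‖ ≠ 1} => (Disc.seg j.1 e').map (discMap k).continuous) ?_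
      (fun _ => p) (p.continuous.comp continuous_snd)
    refine (discMap k).continuous.comp ?_
    have h1 : Continuous fun r : {e : Disc // ‖e.1‖ ≠ 1} × I =>
        (Disc.seg r.1.1 e').toContinuousMap :=
      Disc.continuous_seg.comp
        (by fun_prop : Continuous fun r : {e : Disc // ‖e.1‖ ≠ 1} × I => (r.1.1, e'))
    exact h1.eval continuous_snd
  exact ⟨wellTargeted_of_family hv γ hγ ⟨e, he⟩, locallyWellTargeted_of_family hv γ hγ ⟨e, he⟩⟩

/-- The radial path from a point to the base. -/
def radialPath (x : AttachDiscs φ) : Path x (Adj.base (retr x)) :=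
  ⟨radial x, radial_zero x, radial_one x⟩

end

variable {Z : Type u} {K : Type v} [TopologicalSpace Z] {φ : (Σ _ : K, Disc) → LoopWedge Z}

/-- The path from a point radially to the base and then along a circle to the base point. -/
def homePath {i : I} (hi : i = 0 ∨ i = 1) (x : AttachDiscs φ) : Path x (Adj.base LoopWedge.pt) :=
  (radialPath x).trans (basePath (LoopWedge.slidePath hi (retr x)))

theorem wellTargeted_homePath (hφ : ∀ k, ContinuousOn (fun e => φ ⟨k, e⟩) {e | ‖e.1‖ = 1})
    {i : I} (hi : i = 0 ∨ i = 1) {x : AttachDiscs φ} (hx : x ∈ Punctured)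
    (hx' : retr x ≠ LoopWedge.pt) :
    WellTargeted (ofPath (homePath hi x)) ∧ LocallyWellTargeted (ofPath (homePath hi x)) := by
  let V : Set (AttachDiscs φ) := Punctured ∩ retr ⁻¹' {b | b ≠ LoopWedge.pt}
  have hV : IsOpen V :=
    (continuousOn_retr hφ).isOpen_inter_preimage isOpen_punctured LoopWedge.isOpen_ne_pt
  have hcont : Continuous fun r : V × I => homePath hi r.1.1 r.2 := by
    refine Path.trans_continuous_family (fun j : V => radialPath j.1) ?_
      (fun j : V => basePath (LoopWedge.slidePath hi (retr j.1))) ?_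
    · have h : Continuous fun j : V => radial j.1 :=
        continuousOn_radial.comp_continuous continuous_subtype_val fun j => j.2.1
      exact (h.comp continuous_fst).eval continuous_snd
    · have h1 : Continuous fun j : V => retr j.1 :=
        (continuousOn_retr hφ).comp_continuous continuous_subtype_val fun j => j.2.1
      have h2 : Continuous fun j : V => LoopWedge.slide i (retr j.1) :=
        (LoopWedge.continuousOn_slide i).comp_continuous h1 fun j => j.2.2
      exact Adj.continuous_base.comp ((h2.comp continuous_fst).eval continuous_snd)
  have hopen := hV.isOpenMap_subtype_val
  exact ⟨wellTargeted_of_family hopen (fun j : V => homePath hi j.1) hcont ⟨x, hx, hx'⟩,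
    locallyWellTargeted_of_family hopen (fun j : V => homePath hi j.1) hcont ⟨x, hx, hx'⟩⟩

/-- At base points other than `pt` the home paths vary continuously. At interior points they need
not, because of the disc center and of points retracting to `pt`; there only the start of the first
segment is varied, its end and the rest of the path staying fixed. -/
theorem wellTargeted_homePath_of_ne
    (hφ : ∀ k, ContinuousOn (fun e => φ ⟨k, e⟩) {e | ‖e.1‖ = 1})
    {i : I} (hi : i = 0 ∨ i = 1) {x : AttachDiscs φ} (hx : x ≠ Adj.base LoopWedge.pt) :
    WellTargeted (ofPath (homePath hi x)) ∧ LocallyWellTargeted (ofPath (homePath hi x)) := by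
  rcases x with b | c
  · exact wellTargeted_homePath hφ hi (x := Adj.base b) trivial fun h => hx (congrArg Adj.base h)
  · exact wellTargeted_of_seg (k := c.1.1) (e := c.1.2) c.2 _ (fun t => rfl) _

theorem locallyWellTargeted_refl_base
    (hφ : ∀ k, ContinuousOn (fun e => φ ⟨k, e⟩) {e | ‖e.1‖ = 1}) :
    LocallyWellTargeted (ofPath (Path.refl (Adj.base LoopWedge.pt : AttachDiscs φ))) := by
  refine locallyWellTargeted_refl fun W hW hpt => ?_
  have h1 : IsOpen (Punctured ∩ radial ⁻¹' {g | range g ⊆ W} : Set (AttachDiscs φ)) :=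
    continuousOn_radial.isOpen_inter_preimage isOpen_punctured
      (ContinuousMap.isOpen_setOfPred_range_subset hW)
  -- Near the base point one of the two directions along the circle stays in `W`, though which one
  -- depends on the point.
  have h2 : IsOpen (Punctured ∩ retr ⁻¹' _ : Set (AttachDiscs φ)) :=
    (continuousOn_retr hφ).isOpen_inter_preimage isOpen_punctured
      (LoopWedge.isOpen_slide_subset (hW.preimage Adj.continuous_base) hpt)
  have m1 : (Adj.base LoopWedge.pt : AttachDiscs φ) ∈
      (Punctured ∩ radial ⁻¹' {g | range g ⊆ W} : Set (AttachDiscs φ)) :=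
    ⟨trivial, range_subset_iff.2 fun _ => hpt⟩
  filter_upwards [h1.mem_nhds m1,
    h2.mem_nhds ⟨trivial, Or.inl (range_subset_iff.2 fun _ => hpt)⟩] with a ha ha' hne
  have key : ∀ {i : I} (hi : i = 0 ∨ i = 1),
      range (LoopWedge.slide i (retr a)) ⊆ Adj.base ⁻¹' W →
      ∃ γ : Path a (Adj.base LoopWedge.pt), range γ ⊆ W ∧ WellTargeted (ofPath γ) := by
    intro i hi hr
    refine ⟨homePath hi a, ?_, (wellTargeted_homePath_of_ne hφ hi hne).1⟩
    rw [homePath, Path.trans_range]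
    exact union_subset ha.2 (range_subset_iff.2 fun t => hr (mem_range_self t))
  exact ha'.2.elim (key (Or.inl rfl)) (key (Or.inr rfl))

/-- Attaching discs to `LoopWedge Z` gives a locally wep-connected space. -/
theorem locallyWepConnected (hφ : ∀ k, ContinuousOn (fun e => φ ⟨k, e⟩) {e | ‖e.1‖ = 1}) :
    LocallyWepConnected (AttachDiscs φ) := by
  refine PathsTo.locallyWepConnected (x₀ := Adj.base LoopWedge.pt) fun x => ?_
  by_cases hx : x = Adj.base LoopWedge.pt
  · subst hx
    exact ⟨_, locallyWellTargeted_refl_base hφ⟩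
  · exact ⟨_, (wellTargeted_homePath_of_ne hφ (Or.inl rfl) hx).2⟩

end AttachDiscs

end CellAttachmentWep


/-! ### The space built from loops and null-homotopies of the target -/

noncomputable section Approximation

namespace LoopWedge

variable {Y : Type u} [TopologicalSpace Y] {y₀ : Y}

theorem apply_of_end (c : Path y₀ y₀ × I) (h : c.2 = 0 ∨ c.2 = 1) : c.1 c.2 = y₀ := by
  rcases h with h | h <;> simp [h]

/-- Evaluation of loops, as a map on `LoopWedge (Ω(Y, y₀))`. -/
def eval : C(LoopWedge (Path y₀ y₀), Y) :=
  ⟨Adj.desc (fun _ => y₀) fun c => c.1 c.2,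
    Adj.continuous_desc continuous_const (by fun_prop) apply_of_end⟩

theorem eval_char (c : Path y₀ y₀ × I) : eval (Adj.char c : LoopWedge (Path y₀ y₀)) = c.1 c.2 :=
  Adj.desc_char (f := fun _ => y₀) (g := fun c : Path y₀ y₀ × I => c.1 c.2) apply_of_end c

/-- The loop in `LoopWedge (Ω(Y, y₀))` that runs along the circle with index `γ`. -/
def circleLoop (γ : Path y₀ y₀) : Path (pt : LoopWedge (Path y₀ y₀)) pt where
  toFun t := Adj.char (γ, t)
  continuous_toFun := Adj.continuous_char.comp (by fun_prop)
  source' := char_eq_pt (Or.inl rfl)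
  target' := char_eq_pt (Or.inr rfl)

end LoopWedge

open LoopWedge

/-- The maps from the boundary of the disc to `LoopWedge (Ω(Y, y₀))`, together with an extension
of their composition with `LoopWedge.eval` to the disc. -/
def NullDisc {Y : Type u} [TopologicalSpace Y] (y₀ : Y) : Type u :=
  {d : (Disc → LoopWedge (Path y₀ y₀)) × C(Disc, Y) //
    ContinuousOn d.1 {e | ‖e.1‖ = 1} ∧ ∀ e, ‖e.1‖ = 1 → d.2 e = eval (d.1 e)}

namespace NullDisc

variable {Y : Type u} [TopologicalSpace Y] {y₀ : Y}

/-- The attaching map of all the discs. -/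
def attach (c : Σ _ : NullDisc y₀, Disc) : LoopWedge (Path y₀ y₀) := c.1.1.1 c.2

variable (y₀) in
/-- The space obtained from `LoopWedge (Ω(Y, y₀))` by attaching a disc for each element of
`NullDisc y₀`. -/
abbrev Space : Type u := AttachDiscs (attach (y₀ := y₀))

/-- The canonical map to `Y`. -/
def toTarget : C(Space y₀, Y) :=
  ⟨Adj.desc eval fun c => c.1.1.2 c.2, Adj.continuous_desc eval.continuous
    (continuous_sigma fun d => d.1.2.continuous) fun c hc => c.1.2.2 c.2 hc⟩

theorem continuousOn_attach (d : NullDisc y₀) :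
    ContinuousOn (fun e => attach ⟨d, e⟩) {e | ‖e.1‖ = 1} := d.2.1

/-- The map from the square to the disc which identifies them. -/
def ofSquare (p : I × I) : Disc :=
  ⟨(2 * (p.1 : ℝ) - 1, 2 * (p.2 : ℝ) - 1), by
    have h1 := p.1.2
    have h2 := p.2.2
    simp only [mem_closedBall_zero_iff, Prod.norm_def, Real.norm_eq_abs, sup_le_iff, abs_le]
    refine ⟨⟨?_, ?_⟩, ⟨?_, ?_⟩⟩ <;> linarith [h1.1, h1.2, h2.1, h2.2]⟩

/-- The inverse of `ofSquare`. -/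
def toSquare (e : Disc) : I × I :=
  (projIcc 0 1 zero_le_one ((e.1.1 + 1) / 2), projIcc 0 1 zero_le_one ((e.1.2 + 1) / 2))

theorem continuous_ofSquare : Continuous ofSquare := by
  unfold ofSquare
  fun_prop

theorem continuous_toSquare : Continuous toSquare := by
  unfold toSquare
  exact (continuous_projIcc.comp (by fun_prop)).prodMk (continuous_projIcc.comp (by fun_prop))

theorem toSquare_ofSquare (p : I × I) : toSquare (ofSquare p) = p := by
  have h : ∀ t : I, projIcc (0 : ℝ) 1 zero_le_one ((2 * (t : ℝ) - 1 + 1) / 2) = t := by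
    intro t
    convert projIcc_val zero_le_one t using 2
    ring
  exact Prod.ext (h p.1) (h p.2)

/-- The sign of the first coordinate is recorded on the left and right sides because `boundaryMap`
branches on it. -/
theorem toSquare_of_norm {e : Disc} (he : ‖e.1‖ = 1) :
    (e.1.1 ≤ 0 ∧ (toSquare e).1 = 0) ∨ (0 < e.1.1 ∧ (toSquare e).1 = 1) ∨
      (toSquare e).2 = 0 ∨ (toSquare e).2 = 1 := by
  have hl : ∀ {r : ℝ}, r = -1 → projIcc (0 : ℝ) 1 zero_le_one ((r + 1) / 2) = 0 := by
    rintro r rfl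
    exact projIcc_of_le_left _ (by norm_num)
  have hr : ∀ {r : ℝ}, r = 1 → projIcc (0 : ℝ) 1 zero_le_one ((r + 1) / 2) = 1 := by
    rintro r rfl
    exact projIcc_of_right_le _ (by norm_num)
  rw [Prod.norm_def, Real.norm_eq_abs, Real.norm_eq_abs] at he
  rcases max_choice |e.1.1| |e.1.2| with h | h <;> rw [h] at he <;>
    rcases eq_or_eq_neg_of_abs_eq he with h' | h'
  · exact Or.inr (Or.inl ⟨by linarith, hr h'⟩)
  · exact Or.inl ⟨by linarith, hl h'⟩
  · exact Or.inr (Or.inr (Or.inr (hr h')))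
  · exact Or.inr (Or.inr (Or.inl (hl h')))

/-- The map on the disc which on the boundary runs along `γ` on the left side and is constant
on the other sides. -/
def boundaryMap (γ : Path (pt : LoopWedge (Path y₀ y₀)) pt) (e : Disc) :
    LoopWedge (Path y₀ y₀) :=
  if e.1.1 ≤ 0 then γ (toSquare e).2 else pt

theorem boundaryMap_of_snd (γ : Path (pt : LoopWedge (Path y₀ y₀)) pt) {e : Disc}
    (h : (toSquare e).2 = 0 ∨ (toSquare e).2 = 1) : boundaryMap γ e = pt := by
  unfold boundaryMap
  rcases h with h | h <;> simp [h]

/-- On the boundary the two branches meet only at the midpoints of the top and bottom sides, where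
`γ` is at `pt`. Values in the interior play no role in the attachment. -/
theorem continuousOn_boundaryMap (γ : Path (pt : LoopWedge (Path y₀ y₀)) pt) :
    ContinuousOn (boundaryMap γ) {e | ‖e.1‖ = 1} := by
  rw [continuousOn_iff_continuous_domRestrict]
  refine Continuous.if_le (γ.continuous.comp (continuous_snd.comp
    (continuous_toSquare.comp continuous_subtype_val))) continuous_const (by fun_prop)
    continuous_const ?_
  rintro ⟨e, he⟩ h0
  change e.1.1 = 0 at h0
  have hfst : (toSquare e).1 ≠ 0 ∧ (toSquare e).1 ≠ 1 := by
    have : ((toSquare e).1 : ℝ) = 1 / 2 := by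
      simp only [toSquare, h0]
      rw [projIcc_of_mem _ (by constructor <;> norm_num)]
      norm_num
    constructor <;> intro h <;> rw [h] at this <;> norm_num at this
  have h2 : (toSquare e).2 = 0 ∨ (toSquare e).2 = 1 := by
    rcases toSquare_of_norm he with h | h | h
    · exact absurd h.2 hfst.1
    · exact absurd h.2 hfst.2
    · exact h
  change γ (toSquare e).2 = pt
  rcases h2 with h | h <;> simp [h]

theorem norm_ofSquare {p : I × I} (h : p.1 = 0 ∨ p.1 = 1 ∨ p.2 = 0 ∨ p.2 = 1) :
    ‖(ofSquare p).1‖ = 1 := by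
  refine le_antisymm (mem_closedBall_zero_iff.1 (ofSquare p).2) ?_
  rw [Prod.norm_def, Real.norm_eq_abs, Real.norm_eq_abs]
  rcases h with h | h | h | h
  · exact le_max_of_le_left (by norm_num [ofSquare, h])
  · exact le_max_of_le_left (by norm_num [ofSquare, h])
  · exact le_max_of_le_right (by norm_num [ofSquare, h])
  · exact le_max_of_le_right (by norm_num [ofSquare, h])

/-- The disc given by a loop whose image in `Y` is null-homotopic. -/
def ofHomotopy (γ : Path (pt : LoopWedge (Path y₀ y₀)) pt)
    (H : Path.Homotopy (γ.map eval.continuous) (Path.refl y₀)) : NullDisc y₀ :=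
  ⟨(boundaryMap γ, ⟨fun e => H (toSquare e), H.continuous.comp continuous_toSquare⟩),
    continuousOn_boundaryMap γ, fun e he => by
      change H (toSquare e) = eval (boundaryMap γ e)
      rcases toSquare_of_norm he with ⟨h, h'⟩ | ⟨h, h'⟩ | h
      · have : toSquare e = (0, (toSquare e).2) := Prod.ext h' rfl
        rw [this, boundaryMap, if_pos h]
        exact H.map_zero_left _
      · have : toSquare e = (1, (toSquare e).2) := Prod.ext h' rfl
        rw [this, boundaryMap, if_neg (not_le.2 h)]
        exact H.map_one_left _
      · rw [boundaryMap_of_snd γ h]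
        have : toSquare e = ((toSquare e).1, (toSquare e).2) := rfl
        rw [this]
        rcases h with h | h <;> rw [h]
        · exact H.source _
        · exact H.target _⟩

/-- The null-homotopy in `Y` is itself the datum of an attached disc, and the characteristic map of
that disc, read on the square, is a null-homotopy in `Space y₀`. -/
theorem homotopic_refl_of_eval {γ : Path (pt : LoopWedge (Path y₀ y₀)) pt}
    (h : Path.Homotopic (γ.map eval.continuous) (Path.refl y₀)) :
    (AttachDiscs.basePath γ : Path (_ : Space y₀) _).Homotopic (Path.refl _) := by
  obtain ⟨H⟩ := h
  have hd : ∀ p : I × I, (p.1 = 0 ∨ p.1 = 1 ∨ p.2 = 0 ∨ p.2 = 1) →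
      (AttachDiscs.discMap (ofHomotopy γ H) (ofSquare p) : Space y₀) =
        Adj.base (boundaryMap γ (ofSquare p)) :=
    fun p hp => AttachDiscs.discMap_of_norm (norm_ofSquare hp)
  have hsnd : ∀ s t : I, (t = 0 ∨ t = 1) → boundaryMap γ (ofSquare (s, t)) = pt := fun s t ht =>
    boundaryMap_of_snd γ (by rwa [toSquare_ofSquare])
  refine ⟨⟨⟨⟨fun p => AttachDiscs.discMap (ofHomotopy γ H) (ofSquare p),
    (AttachDiscs.discMap _).continuous.comp continuous_ofSquare⟩, fun t => ?_, fun t => ?_⟩,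
    fun s t ht => ?_⟩⟩
  · change AttachDiscs.discMap (ofHomotopy γ H) (ofSquare (0, t)) = Adj.base (γ t)
    rw [hd _ (by simp), boundaryMap, if_pos (by norm_num [ofSquare]), toSquare_ofSquare]
  · change AttachDiscs.discMap (ofHomotopy γ H) (ofSquare (1, t)) = Adj.base pt
    rw [hd _ (by simp), boundaryMap, if_neg (by norm_num [ofSquare])]
  · change AttachDiscs.discMap (ofHomotopy γ H) (ofSquare (s, t)) = Adj.base (γ t)
    have ht' : t = 0 ∨ t = 1 := ht
    rw [hd _ (by rcases ht' with h | h <;> simp [h]), hsnd s t ht']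
    rcases ht' with h | h <;> simp [h]

end NullDisc

end Approximation

theorem mainTheorem11 {Y : Type u} [TopologicalSpace Y] (y₀ : Y) :
    ∃ (X : Type u) (_ : TopologicalSpace X) (x₀ : X) (f : C(X, Y)) (hf : f x₀ = y₀),
      LocallyWepConnected X ∧
      ∃ e : PiOneTau X x₀ ≃ₜ* PiOneTau Y y₀, ∀ g : PiOneTau X x₀, e g = PiOneTau.map f hf g := by
  refine ⟨NullDisc.Space y₀, inferInstance, Adj.base LoopWedge.pt, NullDisc.toTarget, rfl,
    AttachDiscs.locallyWepConnected NullDisc.continuousOn_attach, ?_⟩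
  refine PiOneTau.exists_continuousMulEquiv NullDisc.toTarget rfl
    (fun γ => AttachDiscs.basePath (LoopWedge.circleLoop γ)) ?_ (fun γ t => LoopWedge.eval_char (γ, t)) fun δ hδ => ?_
  -- Uncurried, the section is the characteristic map on `Ω(Y, y₀) × I`, continuous by the choice of
  -- topology on `LoopWedge`.
  · refine continuous_induced_rng.2 (ContinuousMap.continuous_of_continuous_uncurry _ ?_)
    exact Adj.continuous_base.comp Adj.continuous_char
  · obtain ⟨γ, hγ⟩ := AttachDiscs.exists_homotopic_basePath NullDisc.continuousOn_attach
      (LoopWedge.slidePath (Or.inl rfl)) δ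
    refine hγ.trans (NullDisc.homotopic_refl_of_eval ?_)
    exact (hγ.symm.map NullDisc.toTarget).trans hδ
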